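/- Let $G$ be a finite abelian group. A linking pairing on a finite abelian group $H$ is a symmetric bilinear map $H\times H\to\mathbb{Q}/\mathbb{Z}$ which is non-singular, i.e. whose adjoint $H\to\operatorname{Hom}(H,\mathbb{Q}/\mathbb{Z})$ is an isomorphism. For an integer $a\ge 1$ and $b\in\mathbb{Z}$ let $[b/a]$ denote the symmetric bilinear pairing $([v],[v'])\mapsto bvv'/a$ on $\mathbb{Z}/a\mathbb{Z}$. For a symmetric integral $m\times m$ matrix $A$ with $\det A\neq 0$, let $\iota(A)$ denote the linking pairing $([v],[v'])\mapsto {}^t v A^{-1}v'$ on $\mathbb{Z}^m/A\mathbb{Z}^m$. Let $\phi$ be any linking pairing on $G$. Then there exist $N\ge 0$, integers $a_1,\dots,a_N\ge 1$, each dividing the order of $G$, and integers $b_1,\dots,b_N$ such that each $[b_i/a_i]$ is a linking pairing, and there exist $\nu\ge 0$ and non-zero integers $n_1,\dots,n_\nu$, such that $$\phi\oplus\bigoplus_{i=1}^N [b_i/a_i]\;\cong\;\iota\Big(\bigoplus_{\xi=1}^{\nu}(n_\xi)\Big),$$ where $\oplus$ is the orthogonal direct sum, $\bigoplus_\xi (n_\xi)$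 is the diagonal matrix with entries $n_1,\dots,n_\nu$, and $\cong$ means that some group isomorphism carries one pairing to the other. -/

import Mathlib

namespace Ohtsuki

/-- The group `ℚ / ℤ`. -/
abbrev QmodZ : Type := AddCircle (1 : ℚ)

/-- Bilinear maps `G × G → ℚ / ℤ` on an abelian group `G`. -/
abbrev Pairing (G : Type*) [AddCommGroup G] : Type _ := LinearMap.BilinMap ℤ G QmodZ

/-- A linking pairing: a symmetric bilinear map `G × G → ℚ / ℤ` which is non-singular, that is,
whose adjoint map `G → Hom(G, ℚ / ℤ)` is bijective. -/
structure IsLinkingPairing {G : Type*} [AddCommGroup G] (φ : Pairing G) : Prop where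
  symm : ∀ x y, φ x y = φ y x
  nonsingular : Function.Bijective (fun x : G => (φ x : G →ₗ[ℤ] QmodZ))

/-- Two pairings are isomorphic if some group isomorphism carries one to the other. -/
def IsIsometric {G H : Type*} [AddCommGroup G] [AddCommGroup H]
    (φ : Pairing G) (ψ : Pairing H) : Prop :=
  ∃ e : G ≃+ H, ∀ x y, ψ (e x) (e y) = φ x y

/-- The (orthogonal) direct sum of two pairings. -/
def prodPairing {G H : Type*} [AddCommGroup G] [AddCommGroup H]
    (φ : Pairing G) (ψ : Pairing H) : Pairing (G × H) :=
  φ.compl₁₂ (LinearMap.fst ℤ G H) (LinearMap.fst ℤ G H) +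
    ψ.compl₁₂ (LinearMap.snd ℤ G H) (LinearMap.snd ℤ G H)

theorem prodPairing_apply {G H : Type*} [AddCommGroup G] [AddCommGroup H]
    (φ : Pairing G) (ψ : Pairing H) (x y : G × H) :
    prodPairing φ ψ x y = φ x.1 y.1 + ψ x.2 y.2 := rfl

/-- The (orthogonal) direct sum of a finite family of pairings. -/
def piPairing {ι : Type*} [Fintype ι] {G : ι → Type*} [∀ i, AddCommGroup (G i)]
    (ψ : ∀ i, Pairing (G i)) : Pairing (∀ i, G i) :=
  ∑ i, (ψ i).compl₁₂ (LinearMap.proj i) (LinearMap.proj i)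

theorem piPairing_apply {ι : Type*} [Fintype ι] {G : ι → Type*} [∀ i, AddCommGroup (G i)]
    (ψ : ∀ i, Pairing (G i)) (x y : ∀ i, G i) :
    piPairing ψ x y = ∑ i, ψ i (x i) (y i) := by
  simp [piPairing, LinearMap.sum_apply]

/-- The homomorphism `ℤ / a → ℚ / ℤ` sending the class of `v` to the class of `v / a`. -/
noncomputable def zmodToQmodZ (a : ℕ) : ZMod a →+ QmodZ :=
  ZMod.lift a ⟨zmultiplesHom QmodZ (((1 / a : ℚ)) : QmodZ), by
    rcases eq_or_ne a 0 with rfl | ha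
    · simp
    · have h : (a : ℚ) ≠ 0 := by exact_mod_cast ha
      rw [zmultiplesHom_apply, ← AddCircle.coe_zsmul]
      simp [h]⟩

/-- The pairing `[b/a]` on `ℤ / a`, given by `([v], [v']) ↦ b v v' / a`. -/
noncomputable def cyclicPairing (b : ℤ) (a : ℕ) : Pairing (ZMod a) :=
  (LinearMap.mul ℤ (ZMod a)).compr₂ (b • (zmodToQmodZ a).toIntLinearMap)

theorem cyclicPairing_apply (b : ℤ) (a : ℕ) (v v' : ℤ) :
    cyclicPairing b a (v : ZMod a) (v' : ZMod a) = ((b * v * v' / a : ℚ) : QmodZ) := by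
  have h : cyclicPairing b a (v : ZMod a) (v' : ZMod a)
      = b • zmodToQmodZ a (((v * v' : ℤ)) : ZMod a) := by
    rw [Int.cast_mul]; rfl
  rw [h, zmodToQmodZ, ZMod.lift_coe, zmultiplesHom_apply, ← AddCircle.coe_zsmul,
    ← AddCircle.coe_zsmul]
  congr 1
  simp only [zsmul_eq_mul]
  push_cast
  ring

section Matrix

variable {m : Type*} [Fintype m] [DecidableEq m]

/-- The bilinear map `(v, v') ↦ ᵗv A⁻¹ v'` on `ℤ^m`, with values in `ℚ / ℤ`. -/
noncomputable def preIota (A : Matrix m m ℤ) : Pairing (m → ℤ) :=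
  LinearMap.mk₂ ℤ
    (fun v v' => ((dotProduct (fun i => (v i : ℚ))
      ((A.map (Int.cast : ℤ → ℚ))⁻¹.mulVec fun i => (v' i : ℚ)) : ℚ) : QmodZ))
    (fun v w u => by
      rw [← AddCircle.coe_add, ← add_dotProduct]
      congr 2; funext i; simp)
    (fun c v u => by
      rw [← AddCircle.coe_zsmul, zsmul_eq_mul, ← smul_eq_mul, ← smul_dotProduct]
      congr 2; funext i; simp)
    (fun v w u => by
      rw [← AddCircle.coe_add, ← dotProduct_add, ← Matrix.mulVec_add]
      congr 3; funext i; simp)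
    (fun c v u => by
      rw [← AddCircle.coe_zsmul, zsmul_eq_mul, ← smul_eq_mul, ← dotProduct_smul,
        ← Matrix.mulVec_smul]
      congr 3; funext i; simp)

theorem preIota_apply (A : Matrix m m ℤ) (v v' : m → ℤ) :
    preIota A v v' = ((dotProduct (fun i => (v i : ℚ))
      ((A.map (Int.cast : ℤ → ℚ))⁻¹.mulVec fun i => (v' i : ℚ)) : ℚ) : QmodZ) := rfl

theorem preIota_symm (A : Matrix m m ℤ) (hA : A.IsSymm) (v v' : m → ℤ) :
    preIota A v v' = preIota A v' v := by
  have h : ((A.map (Int.cast : ℤ → ℚ))⁻¹).transpose = (A.map (Int.cast : ℤ → ℚ))⁻¹ := by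
    rw [Matrix.transpose_nonsing_inv, ← Matrix.transpose_map, hA.eq]
  rw [preIota_apply, preIota_apply, Matrix.dotProduct_mulVec, ← Matrix.mulVec_transpose, h,
    dotProduct_comm]

theorem preIota_mulVec (A : Matrix m m ℤ) (hdet : A.det ≠ 0) (v w : m → ℤ) :
    preIota A v (A.mulVec w) = 0 := by
  have hu : IsUnit (A.map (Int.cast : ℤ → ℚ)).det := by
    have : (A.map (Int.cast : ℤ → ℚ)).det = ((A.det : ℤ) : ℚ) :=
      ((Int.castRingHom ℚ).map_det A).symm
    rw [this]
    exact (Int.cast_ne_zero.mpr hdet).isUnit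
  have h : (fun i => ((A.mulVec w i : ℤ) : ℚ))
      = (A.map (Int.cast : ℤ → ℚ)).mulVec fun i => (w i : ℚ) := by
    funext i
    simp [Matrix.mulVec, dotProduct]
  rw [preIota_apply, h, Matrix.mulVec_mulVec, Matrix.nonsing_inv_mul _ hu, Matrix.one_mulVec]
  refine (AddCircle.coe_eq_zero_iff (1 : ℚ)).mpr ⟨dotProduct v w, ?_⟩
  simp [dotProduct]

/-- The quotient group `ℤ^m / A ℤ^m`. -/
abbrev Coker (A : Matrix m m ℤ) : Type _ := (m → ℤ) ⧸ LinearMap.range A.mulVecLin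

/-- The pairing `ι(A)` on `ℤ^m / A ℤ^m` induced by a non-singular symmetric integral matrix `A`,
namely `([v], [v']) ↦ ᵗv A⁻¹ v'`. -/
noncomputable def iota (A : Matrix m m ℤ) (hA : A.IsSymm) (hdet : A.det ≠ 0) :
    Pairing (Coker A) :=
  (preIota A).liftQ₂ (LinearMap.range A.mulVecLin) (LinearMap.range A.mulVecLin)
    (by
      rintro _ ⟨w, rfl⟩
      exact LinearMap.mem_ker.mpr (LinearMap.ext fun v =>
        (preIota_symm A hA _ v).trans (preIota_mulVec A hdet v w)))
    (by
      rintro _ ⟨w, rfl⟩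
      exact LinearMap.mem_ker.mpr (LinearMap.ext fun v => preIota_mulVec A hdet v w))

theorem iota_mk (A : Matrix m m ℤ) (hA : A.IsSymm) (hdet : A.det ≠ 0) (v v' : m → ℤ) :
    iota A hA hdet (Submodule.Quotient.mk v) (Submodule.Quotient.mk v')
      = ((dotProduct (fun i => (v i : ℚ))
      ((A.map (Int.cast : ℤ → ℚ))⁻¹.mulVec fun i => (v' i : ℚ)) : ℚ) : QmodZ) :=
  rfl

end Matrix

end Ohtsuki

/-! The argument has two halves.

Every nondegenerate pairing becomes diagonal after adding a diagonal one
(`isStablyDiagonal_of_isNondegenerate`, by induction on the order of the group). An element `z`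
killed by `n` with square `c/n`, `c` prime to `n`, splits off `[c/n]`. Some `x`, `y` killed by `p ^
k` pair to `u / p ^ k` with `u` prime to `p`. For odd `p` one of `x`, `y`, `x + y` splits off; for
`p = 2` the even block that may remain is diagonalised after adding `[u / 2 ^ k]`.

By Lagrange, `b` is a sum of four squares modulo `a`, that is, the norm of a quaternion.
Multiplication by that quaternion turns four copies of `[1/a]` into four copies of `[b/a]`
(`isIsometric_four_copies`). Hence three further copies of a diagonal pairing complete it to a sum
of pairings `[1/a]`, which is `ι` of a diagonal matrix (`isIsometric_piPairing_iota`). -/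

namespace Ohtsuki

/-! ### Isometries and direct sums. -/

section Isometry

variable {G H K L : Type*} [AddCommGroup G] [AddCommGroup H] [AddCommGroup K] [AddCommGroup L]

theorem IsIsometric.refl (φ : Pairing G) : IsIsometric φ φ :=
  ⟨AddEquiv.refl G, fun _ _ => rfl⟩

theorem IsIsometric.symm {φ : Pairing G} {ψ : Pairing H} (h : IsIsometric φ ψ) :
    IsIsometric ψ φ := by
  obtain ⟨e, he⟩ := h
  exact ⟨e.symm, fun x y => by rw [← he]; simp⟩

theorem IsIsometric.trans {φ : Pairing G} {ψ : Pairing H} {χ : Pairing K}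
    (h : IsIsometric φ ψ) (h' : IsIsometric ψ χ) : IsIsometric φ χ := by
  obtain ⟨e, he⟩ := h
  obtain ⟨f, hf⟩ := h'
  exact ⟨e.trans f, fun x y => by simp [hf, he]⟩

theorem IsIsometric.prod {φ : Pairing G} {ψ : Pairing H} {φ' : Pairing K} {ψ' : Pairing L}
    (h : IsIsometric φ φ') (h' : IsIsometric ψ ψ') :
    IsIsometric (prodPairing φ ψ) (prodPairing φ' ψ') := by
  obtain ⟨e, he⟩ := h
  obtain ⟨f, hf⟩ := h'
  exact ⟨e.prodCongr f, fun x y => by simp only [prodPairing_apply, ← he, ← hf]; rfl⟩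

theorem isIsometric_prod_assoc (φ : Pairing G) (ψ : Pairing H) (χ : Pairing K) :
    IsIsometric (prodPairing (prodPairing φ ψ) χ) (prodPairing φ (prodPairing ψ χ)) :=
  ⟨AddEquiv.prodAssoc, fun x y => by simp [prodPairing_apply, add_assoc]⟩

theorem isIsometric_piPairing_reindex {ι κ : Type*} [Fintype ι] [Fintype κ] (e : ι ≃ κ)
    {G : κ → Type*} [∀ i, AddCommGroup (G i)] (ψ : ∀ i, Pairing (G i)) :
    IsIsometric (piPairing ψ) (piPairing fun i => ψ (e i)) :=
  ⟨(LinearEquiv.piCongrLeft ℤ G e).symm.toAddEquiv, fun x y => by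
    simp only [piPairing_apply]
    exact Fintype.sum_equiv e _ _ fun i => rfl⟩

theorem isIsometric_piPairing_sum {ι κ : Type*} [Fintype ι] [Fintype κ]
    {G : ι ⊕ κ → Type*} [∀ i, AddCommGroup (G i)] (ψ : ∀ i, Pairing (G i)) :
    IsIsometric (piPairing ψ)
      (prodPairing (piPairing fun i => ψ (.inl i)) (piPairing fun i => ψ (.inr i))) :=
  ⟨(LinearEquiv.sumPiEquivProdPi ℤ ι κ G).toAddEquiv, fun x y => by
    simp only [prodPairing_apply, piPairing_apply, Fintype.sum_sum_type]
    rfl⟩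

theorem isIsometric_piPairing_unique {ι : Type*} [Unique ι] {G : ι → Type*}
    [∀ i, AddCommGroup (G i)] (ψ : ∀ i, Pairing (G i)) :
    IsIsometric (piPairing ψ) (ψ default) :=
  ⟨(LinearEquiv.piUnique ℤ G).toAddEquiv, fun x y => by
    simp [piPairing_apply]⟩

end Isometry

/-! ### Torsion in `ℚ / ℤ` written as fractions. -/

section Torsion

theorem exists_eq_div_of_nsmul_eq_zero {n : ℕ} (hn : 0 < n) {t : QmodZ} (h : n • t = 0) :
    ∃ d : ℤ, t = ((d / n : ℚ) : QmodZ) := by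
  have hn' : (n : ℚ) ≠ 0 := by exact_mod_cast hn.ne'
  obtain ⟨q, rfl⟩ := QuotientAddGroup.mk_surjective t
  have h' : ((n • q : ℚ) : QmodZ) = 0 := h
  obtain ⟨d, hd⟩ := (AddCircle.coe_eq_zero_iff (1 : ℚ)).mp h'
  refine ⟨d, ?_⟩
  have : q = d / n := by
    rw [eq_div_iff hn']
    simp only [zsmul_eq_mul, nsmul_eq_mul, mul_one] at hd
    rw [hd, mul_comm]
  rw [this]

theorem coe_div_eq_zero_iff {n : ℕ} (hn : 0 < n) (d : ℤ) :
    ((d / n : ℚ) : QmodZ) = 0 ↔ (n : ℤ) ∣ d := by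
  have hn' : (n : ℚ) ≠ 0 := by exact_mod_cast hn.ne'
  rw [AddCircle.coe_eq_zero_iff]
  constructor
  · rintro ⟨k, hk⟩
    refine ⟨k, ?_⟩
    simp only [zsmul_eq_mul, mul_one] at hk
    rw [eq_div_iff hn'] at hk
    rw [mul_comm]
    exact_mod_cast hk.symm
  · rintro ⟨k, rfl⟩
    refine ⟨k, ?_⟩
    push_cast
    field_simp
    simp

theorem zsmul_coe_div (n : ℕ) (c d : ℤ) :
    c • ((d / n : ℚ) : QmodZ) = (((c * d : ℤ) / n : ℚ) : QmodZ) := by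
  rw [← AddCircle.coe_zsmul, zsmul_eq_mul]
  push_cast
  rw [mul_div_assoc]

theorem coe_div_add (n : ℕ) (c d : ℤ) :
    ((c / n : ℚ) : QmodZ) + ((d / n : ℚ) : QmodZ) = (((c + d : ℤ) / n : ℚ) : QmodZ) := by
  rw [← AddCircle.coe_add]
  push_cast
  rw [add_div]

end Torsion

/-! ### Cyclic pairings. -/

theorem cyclicPairing_apply' (b : ℤ) (a : ℕ) (v v' : ℤ) :
    cyclicPairing b a (v : ZMod a) (v' : ZMod a) = (((b * v * v' : ℤ) / a : ℚ) : QmodZ) := by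
  rw [cyclicPairing_apply]; push_cast; rfl

theorem isLinkingPairing_cyclicPairing {a : ℕ} (ha : 0 < a) {b : ℤ} (hb : IsCoprime b (a : ℤ)) :
    IsLinkingPairing (cyclicPairing b a) where
  symm x y := by
    obtain ⟨x, rfl⟩ := ZMod.intCast_surjective x
    obtain ⟨y, rfl⟩ := ZMod.intCast_surjective y
    rw [cyclicPairing_apply', cyclicPairing_apply', mul_right_comm]
  nonsingular := by
    constructor
    · intro x y hxy
      obtain ⟨x, rfl⟩ := ZMod.intCast_surjective x
      obtain ⟨y, rfl⟩ := ZMod.intCast_surjective y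
      have h := LinearMap.congr_fun hxy ((1 : ℤ) : ZMod a)
      simp only [cyclicPairing_apply', mul_one] at h
      rw [← sub_eq_zero, sub_eq_add_neg, ← neg_one_zsmul, zsmul_coe_div, coe_div_add,
        coe_div_eq_zero_iff ha] at h
      rw [← sub_eq_zero, ← Int.cast_sub, ZMod.intCast_zmod_eq_zero_iff_dvd]
      refine hb.symm.dvd_of_dvd_mul_left (h.trans (dvd_of_eq ?_))
      ring
    · intro f
      obtain ⟨d, hd⟩ := exists_eq_div_of_nsmul_eq_zero ha (t := f 1)
        (by rw [← map_nsmul]; simp)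
      obtain ⟨s, t, hst⟩ := hb
      -- `s` inverts `b` modulo `a`, so `s * d` pairs with `1` to `d / a = f 1`.
      refine ⟨((s * d : ℤ) : ZMod a), LinearMap.ext fun v => ?_⟩
      obtain ⟨v, rfl⟩ := ZMod.intCast_surjective v
      have hv : f (v : ZMod a) = v • f 1 := by rw [← map_zsmul]; simp
      simp only [hv, hd, cyclicPairing_apply', zsmul_coe_div]
      rw [← sub_eq_zero, sub_eq_add_neg, ← neg_one_zsmul, zsmul_coe_div, coe_div_add,
        coe_div_eq_zero_iff ha]
      refine ⟨- t * d * v, ?_⟩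
      linear_combination (d * v) * hst

/-! ### Splitting off a cyclic orthogonal summand. -/

/-- A symmetric pairing whose adjoint is injective. -/
structure IsNondegenerate {G : Type*} [AddCommGroup G] (φ : Pairing G) : Prop where
  symm : ∀ x y, φ x y = φ y x
  eq_zero : ∀ x, (∀ y, φ x y = 0) → x = 0

/-- The induction needs only injectivity of the adjoint, which passes directly to sums and to
orthogonal complements. -/
theorem IsLinkingPairing.isNondegenerate {G : Type*} [AddCommGroup G] {φ : Pairing G}
    (h : IsLinkingPairing φ) : IsNondegenerate φ where
  symm := h.symm
  eq_zero x hx := h.nonsingular.1 (by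
    simp only [map_zero]
    exact LinearMap.ext hx)

theorem IsNondegenerate.prod {G H : Type*} [AddCommGroup G] [AddCommGroup H] {φ : Pairing G}
    {ψ : Pairing H} (hφ : IsNondegenerate φ) (hψ : IsNondegenerate ψ) :
    IsNondegenerate (prodPairing φ ψ) where
  symm x y := by rw [prodPairing_apply, prodPairing_apply, hφ.symm, hψ.symm]
  eq_zero x hx := Prod.ext
    (hφ.eq_zero _ fun y => by simpa [prodPairing_apply] using hx (y, 0))
    (hψ.eq_zero _ fun y => by simpa [prodPairing_apply] using hx (0, y))

/-- The restriction of a pairing to the orthogonal complement of an element. -/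
noncomputable abbrev orthogonalPairing {G : Type*} [AddCommGroup G] (φ : Pairing G) (z : G) :
    Pairing (LinearMap.ker (φ z)) :=
  φ.domRestrict₁₂ (LinearMap.ker (φ z)) (LinearMap.ker (φ z))

/-- Orthogonal projection along `z`: if `φ z g = d / n`, the coefficient is `d` times an inverse of
`c` modulo `n`. -/
theorem exists_sub_zsmul_mem_orthogonal {G : Type*} [AddCommGroup G] {φ : Pairing G} {n : ℕ}
    (hn : 0 < n) {z : G} (hz : n • z = 0) {c : ℤ} (hc : IsCoprime c (n : ℤ))
    (hzz : φ z z = ((c / n : ℚ) : QmodZ)) (g : G) : ∃ t : ℤ, φ z (g - t • z) = 0 := by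
  obtain ⟨d, hd⟩ := exists_eq_div_of_nsmul_eq_zero hn (t := φ z g)
    (by rw [← LinearMap.smul_apply, ← map_nsmul, hz]; simp)
  obtain ⟨r, s, hrs⟩ := hc
  refine ⟨r * d, ?_⟩
  rw [map_sub, map_zsmul, hzz, hd, zsmul_coe_div, sub_eq_add_neg, ← neg_one_zsmul, zsmul_coe_div,
    coe_div_add, coe_div_eq_zero_iff hn]
  refine ⟨s * d, ?_⟩
  linear_combination (-d) * hrs

theorem isNondegenerate_orthogonalPairing {G : Type*} [AddCommGroup G] {φ : Pairing G}
    (hφ : IsNondegenerate φ) {n : ℕ} (hn : 0 < n) {z : G} (hz : n • z = 0) {c : ℤ}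
    (hc : IsCoprime c (n : ℤ)) (hzz : φ z z = ((c / n : ℚ) : QmodZ)) :
    IsNondegenerate (orthogonalPairing φ z) where
  symm x y := hφ.symm x y
  eq_zero x hx := by
    refine Subtype.ext (hφ.eq_zero x fun y => ?_)
    obtain ⟨t, ht⟩ := exists_sub_zsmul_mem_orthogonal hn hz hc hzz y
    have h1 : φ x (y - t • z) = 0 := hx ⟨_, ht⟩
    have h2 : φ x z = 0 := (hφ.symm _ _).trans x.2
    rwa [map_sub, map_zsmul, h2, smul_zero, sub_zero] at h1

/-- The projection gives surjectivity. If `t • z + h = 0` with `h` orthogonal to `z`, pairing with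
`z` gives `n ∣ t * c`, hence `n ∣ t`. -/
theorem isIsometric_cyclic_prod_orthogonal {G : Type*} [AddCommGroup G] {φ : Pairing G}
    (hφ : IsNondegenerate φ) {n : ℕ} (hn : 0 < n) {z : G} (hz : n • z = 0) {c : ℤ}
    (hc : IsCoprime c (n : ℤ)) (hzz : φ z z = ((c / n : ℚ) : QmodZ)) :
    IsIsometric (prodPairing (cyclicPairing c n) (orthogonalPairing φ z)) φ := by
  let f : ZMod n →+ G := ZMod.lift n ⟨zmultiplesHom G z, by simpa using hz⟩
  have hf (t : ℤ) : f (t : ZMod n) = t • z := by simp [f]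
  let F : ZMod n × LinearMap.ker (φ z) →+ G :=
    f.coprod (LinearMap.ker (φ z)).subtype.toAddMonoidHom
  have hF (t : ℤ) (h : LinearMap.ker (φ z)) : F ((t : ZMod n), h) = t • z + h := by
    simp [F, hf]
  have hbij : Function.Bijective F := by
    constructor
    · rw [injective_iff_map_eq_zero]
      rintro ⟨t, h⟩ h0
      obtain ⟨t, rfl⟩ := ZMod.intCast_surjective t
      rw [hF] at h0
      have h1 : φ z (t • z + h) = 0 := by rw [h0, map_zero]
      have h2 : φ z h = 0 := h.2
      rw [map_add, map_zsmul, h2, add_zero, hzz, zsmul_coe_div, coe_div_eq_zero_iff hn] at h1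
      have h3 : (n : ℤ) ∣ t := hc.symm.dvd_of_dvd_mul_right h1
      have h4 : t • z = 0 := by
        obtain ⟨k, rfl⟩ := h3
        rw [mul_comm, mul_smul, natCast_zsmul, hz, smul_zero]
      rw [h4, zero_add] at h0
      exact Prod.ext ((ZMod.intCast_zmod_eq_zero_iff_dvd t n).mpr h3) (Subtype.ext h0)
    · intro g
      obtain ⟨t, ht⟩ := exists_sub_zsmul_mem_orthogonal hn hz hc hzz g
      exact ⟨((t : ZMod n), ⟨g - t • z, ht⟩), by rw [hF]; simp⟩
  refine ⟨AddEquiv.ofBijective F hbij, ?_⟩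
  rintro ⟨s, x⟩ ⟨t, y⟩
  obtain ⟨s, rfl⟩ := ZMod.intCast_surjective s
  obtain ⟨t, rfl⟩ := ZMod.intCast_surjective t
  have hx : φ x z = 0 := (hφ.symm _ _).trans x.2
  have hy : φ z y = 0 := y.2
  have h : φ (s • z + x) (t • z + y) = s • t • φ z z + φ x y := by
    simp [hx, hy]
  rw [AddEquiv.ofBijective_apply, AddEquiv.ofBijective_apply, hF, hF, h, prodPairing_apply,
    cyclicPairing_apply', hzz, zsmul_coe_div, zsmul_coe_div]
  congr 3
  push_cast
  ring

theorem card_eq_mul_card_orthogonal {G : Type*} [AddCommGroup G] {φ : Pairing G}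
    (hφ : IsNondegenerate φ) {n : ℕ} (hn : 0 < n) {z : G} (hz : n • z = 0) {c : ℤ}
    (hc : IsCoprime c (n : ℤ)) (hzz : φ z z = ((c / n : ℚ) : QmodZ)) :
    Nat.card G = n * Nat.card (LinearMap.ker (φ z)) := by
  obtain ⟨e, -⟩ := isIsometric_cyclic_prod_orthogonal hφ hn hz hc hzz
  rw [← Nat.card_congr e.toEquiv, Nat.card_prod, Nat.card_zmod]

/-! ### Diagonal and stably diagonal pairings. -/

/-- Pairings isometric to a direct sum of linking pairings `[b/a]` with `a ∣ M`. -/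
def IsDiagonal (M : ℕ) {G : Type*} [AddCommGroup G] (φ : Pairing G) : Prop :=
  ∃ (N : ℕ) (a : Fin N → ℕ) (b : Fin N → ℤ),
    (∀ i, 0 < a i ∧ IsCoprime (b i) (a i : ℤ) ∧ a i ∣ M) ∧
    IsIsometric φ (piPairing fun i => cyclicPairing (b i) (a i))

section IsDiagonal

variable {M : ℕ} {G H : Type*} [AddCommGroup G] [AddCommGroup H]

theorem IsDiagonal.of_isIsometric {φ : Pairing G} {ψ : Pairing H} (h : IsDiagonal M ψ)
    (e : IsIsometric φ ψ) : IsDiagonal M φ := by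
  obtain ⟨N, a, b, hab, f⟩ := h
  exact ⟨N, a, b, hab, e.trans f⟩

theorem IsDiagonal.of_fintype {ι : Type*} [Fintype ι] {a : ι → ℕ} {b : ι → ℤ}
    (hab : ∀ i, 0 < a i ∧ IsCoprime (b i) (a i : ℤ) ∧ a i ∣ M) :
    IsDiagonal M (piPairing fun i => cyclicPairing (b i) (a i)) :=
  ⟨Fintype.card ι, fun j => a ((Fintype.equivFin ι).symm j),
    fun j => b ((Fintype.equivFin ι).symm j), fun _ => hab _,
    isIsometric_piPairing_reindex (Fintype.equivFin ι).symm _⟩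

theorem IsDiagonal.prod {φ : Pairing G} {ψ : Pairing H} (hφ : IsDiagonal M φ)
    (hψ : IsDiagonal M ψ) : IsDiagonal M (prodPairing φ ψ) := by
  obtain ⟨N, a, b, hab, e⟩ := hφ
  obtain ⟨N', a', b', hab', e'⟩ := hψ
  -- The groups `ZMod (a i)` depend on the family, so both families are made restrictions of one on
  -- the sum type; no transport is then needed.
  obtain ⟨A, rfl, rfl⟩ : ∃ A : Fin N ⊕ Fin N' → ℕ,
      a = (fun i => A (.inl i)) ∧ a' = (fun i => A (.inr i)) := ⟨Sum.elim a a', rfl, rfl⟩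
  obtain ⟨B, rfl, rfl⟩ : ∃ B : Fin N ⊕ Fin N' → ℤ,
      b = (fun i => B (.inl i)) ∧ b' = (fun i => B (.inr i)) := ⟨Sum.elim b b', rfl, rfl⟩
  refine IsDiagonal.of_isIsometric (IsDiagonal.of_fintype (a := A) (b := B) ?_)
    ((e.prod e').trans
      (isIsometric_piPairing_sum fun i => cyclicPairing (B i) (A i)).symm)
  rintro (i | i)
  exacts [hab i, hab' i]

theorem isDiagonal_cyclicPairing {a : ℕ} {b : ℤ} (ha : 0 < a) (hb : IsCoprime b (a : ℤ))
    (haM : a ∣ M) : IsDiagonal M (cyclicPairing b a) :=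
  (IsDiagonal.of_fintype (ι := Unit) (a := fun _ => a) (b := fun _ => b)
    fun _ => ⟨ha, hb, haM⟩).of_isIsometric
    (isIsometric_piPairing_unique fun _ : Unit => cyclicPairing b a).symm

theorem isDiagonal_of_subsingleton [Subsingleton G] (φ : Pairing G) : IsDiagonal M φ :=
  ⟨0, Fin.elim0, Fin.elim0, fun i => i.elim0, 
    ⟨⟨0, 0, fun _ => Subsingleton.elim _ _, fun _ => Subsingleton.elim _ _⟩,
      fun _ _ => Subsingleton.elim _ _⟩, fun x y => by
        rw [Subsingleton.elim x 0]; simp⟩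

end IsDiagonal

/-- Pairings that become diagonal after adding a diagonal pairing. -/
def IsStablyDiagonal (M : ℕ) {G : Type*} [AddCommGroup G] (φ : Pairing G) : Prop :=
  ∃ (K : Type) (_ : AddCommGroup K) (ψ : Pairing K), IsDiagonal M ψ ∧
    IsDiagonal M (prodPairing φ ψ)

section IsStablyDiagonal

variable {M : ℕ} {G H : Type*} [AddCommGroup G] [AddCommGroup H]

theorem IsStablyDiagonal.of_isIsometric {φ : Pairing G} {ψ : Pairing H}
    (h : IsStablyDiagonal M ψ) (e : IsIsometric φ ψ) : IsStablyDiagonal M φ := by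
  obtain ⟨K, _, χ, hχ, hψχ⟩ := h
  exact ⟨K, _, χ, hχ, hψχ.of_isIsometric (e.prod (.refl _))⟩

theorem IsStablyDiagonal.diagonal_prod {φ : Pairing G} {ψ : Pairing H} (hφ : IsDiagonal M φ)
    (hψ : IsStablyDiagonal M ψ) : IsStablyDiagonal M (prodPairing φ ψ) := by
  obtain ⟨K, _, χ, hχ, hψχ⟩ := hψ
  exact ⟨K, _, χ, hχ, (hφ.prod hψχ).of_isIsometric (isIsometric_prod_assoc _ _ _)⟩

/-- Licenses enlarging `φ` in the case `p = 2`: the added summand joins the diagonal complement. -/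
theorem IsStablyDiagonal.of_prod_diagonal {K : Type} [AddCommGroup K] {φ : Pairing G}
    {ψ : Pairing K} (hψ : IsDiagonal M ψ) (h : IsStablyDiagonal M (prodPairing φ ψ)) :
    IsStablyDiagonal M φ := by
  obtain ⟨L, _, χ, hχ, h⟩ := h
  exact ⟨K × L, _, prodPairing ψ χ, hψ.prod hχ,
    h.of_isIsometric (isIsometric_prod_assoc _ _ _).symm⟩

theorem IsStablyDiagonal.of_orthogonal {φ : Pairing G} (hφ : IsNondegenerate φ) {n : ℕ}
    (hn : 0 < n) (hnM : n ∣ M) {z : G} (hz : n • z = 0) {c : ℤ} (hc : IsCoprime c (n : ℤ))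
    (hzz : φ z z = ((c / n : ℚ) : QmodZ)) (h : IsStablyDiagonal M (orthogonalPairing φ z)) :
    IsStablyDiagonal M φ :=
  (IsStablyDiagonal.diagonal_prod (isDiagonal_cyclicPairing hn hc hnM) h).of_isIsometric
    (isIsometric_cyclic_prod_orthogonal hφ hn hz hc hzz).symm

end IsStablyDiagonal

/-! ### Stable diagonalisation. -/

/-- Let `g` have order the exponent `p ^ k * m`, with `p` prime to `m`. Then `x = m • g` satisfies
`p ^ (k - 1) • x ≠ 0`, so some `y` pairs nontrivially with that multiple, which keeps `p` out of the
numerator of `φ x y`. -/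
theorem exists_prime_pow_torsion_pair {G : Type*} [AddCommGroup G] [Finite G] [Nontrivial G]
    {φ : Pairing G} (hφ : IsNondegenerate φ) :
    ∃ (p k : ℕ) (x y : G) (u : ℤ), p.Prime ∧ 0 < k ∧ p ^ k ∣ Nat.card G ∧
      p ^ k • x = 0 ∧ p ^ k • y = 0 ∧ ¬ (p : ℤ) ∣ u ∧
      φ x y = ((u / (p ^ k : ℕ) : ℚ) : QmodZ) := by
  set e := AddMonoid.exponent G with he_def
  have he0 : e ≠ 0 := AddMonoid.exponent_ne_zero_of_finite
  have he1 : e ≠ 1 := fun h => not_subsingleton G (AddMonoid.exp_eq_one_iff.mp h)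
  obtain ⟨g, hg⟩ := AddMonoid.exists_addOrderOf_eq_exponent
    (AddMonoid.ExponentExists.of_finite (G := G))
  obtain ⟨p, hp, hpe⟩ := Nat.exists_prime_and_dvd he1
  obtain ⟨k, m, hpm, hem⟩ := Nat.exists_eq_pow_mul_and_not_dvd he0 p hp.ne_one
  have hk : 0 < k := by
    rcases Nat.eq_zero_or_pos k with rfl | hk
    · rw [pow_zero, one_mul] at hem
      exact absurd (hem ▸ hpe) hpm
    · exact hk
  have hm : 0 < m := Nat.pos_of_ne_zero fun h => he0 (by rw [hem, h, mul_zero])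
  have htors (v : G) : p ^ k • m • v = 0 := by
    rw [smul_smul, ← hem]
    exact AddMonoid.exponent_nsmul_eq_zero v
  have hx : p ^ (k - 1) • m • g ≠ 0 := by
    rw [smul_smul]
    intro h
    have h1 := Nat.le_of_dvd (Nat.mul_pos (pow_pos hp.pos _) hm) (addOrderOf_dvd_of_nsmul_eq_zero h)
    rw [hg, ← he_def, hem] at h1
    have h2 : p ^ (k - 1) < p ^ k := Nat.pow_lt_pow_right hp.one_lt (by lia)
    exact absurd (Nat.mul_lt_mul_of_pos_right h2 hm) (not_lt.mpr h1)
  obtain ⟨y, hy⟩ : ∃ y, φ (p ^ (k - 1) • m • g) y ≠ 0 := by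
    by_contra! h
    exact hx (hφ.eq_zero _ h)
  have hq : 0 < p ^ k := pow_pos hp.pos k
  obtain ⟨d, hd⟩ := exists_eq_div_of_nsmul_eq_zero hq (t := φ (m • g) y)
    (by rw [← LinearMap.smul_apply, ← map_nsmul, htors, map_zero, LinearMap.zero_apply])
  have hpd : ¬ (p : ℤ) ∣ d := by
    rintro ⟨c, rfl⟩
    apply hy
    rw [map_nsmul, LinearMap.smul_apply, hd, ← natCast_zsmul, zsmul_coe_div,
      coe_div_eq_zero_iff hq]
    refine ⟨c, ?_⟩
    have h : p ^ k = p ^ (k - 1) * p := by rw [← pow_succ, Nat.sub_add_cancel hk]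
    rw [h]
    push_cast
    ring
  -- Passing to `m • y` makes it `p ^ k`-torsion and multiplies the numerator only by `m`, prime to
  -- `p`.
  refine ⟨p, k, m • g, m • y, m * d, hp, hk, ?_, htors g, htors y, fun h => ?_, ?_⟩
  · exact (Dvd.intro _ hem.symm).trans AddGroup.exponent_dvd_nat_card
  · rcases (Nat.prime_iff_prime_int.mp hp).dvd_or_dvd h with h | h
    · exact hpm (by exact_mod_cast h)
    · exact hpd h
  · rw [map_nsmul, hd, ← natCast_zsmul, zsmul_coe_div]

/-- `M` stays fixed while the order `n` drops, so all denominators divide the order of the original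
group. -/
theorem isStablyDiagonal_of_isNondegenerate (M n : ℕ) : ∀ (G : Type*) [AddCommGroup G] [Finite G]
    (φ : Pairing G), IsNondegenerate φ → Nat.card G = n → Nat.card G ∣ M →
    IsStablyDiagonal M φ := by
  induction n using Nat.strong_induction_on with
  | _ n ih =>
  intro G _ _ φ hφ hn hM
  rcases subsingleton_or_nontrivial G with _ | _
  · exact ⟨PUnit, inferInstance, 0, isDiagonal_of_subsingleton _, isDiagonal_of_subsingleton _⟩
  obtain ⟨p, k, x, y, u, hp, hk, hdvd, hx, hy, hu, hxy⟩ := exists_prime_pow_torsion_pair hφ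
  have hq : 0 < p ^ k := pow_pos hp.pos k
  have hq1 : 1 < p ^ k := Nat.one_lt_pow hk.ne' hp.one_lt
  have hpz : Prime (p : ℤ) := Nat.prime_iff_prime_int.mp hp
  have hcop {c : ℤ} (hc : ¬ (p : ℤ) ∣ c) : IsCoprime c ((p ^ k : ℕ) : ℤ) := by
    push_cast
    exact ((hpz.irreducible.coprime_iff_not_dvd.mpr hc).symm).pow_right
  have split {z : G} (hz : p ^ k • z = 0) {c : ℤ} (hc : ¬ (p : ℤ) ∣ c)
      (hzz : φ z z = ((c / (p ^ k : ℕ) : ℚ) : QmodZ)) : IsStablyDiagonal M φ := by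
    have hcard := card_eq_mul_card_orthogonal hφ hq hz (hcop hc) hzz
    refine .of_orthogonal hφ hq (hdvd.trans hM) hz (hcop hc) hzz (ih _ ?_ _ _
      (isNondegenerate_orthogonalPairing hφ hq hz (hcop hc) hzz) rfl
      ((Dvd.intro_left _ hcard.symm).trans hM))
    rw [← hn, hcard]
    exact lt_mul_of_one_lt_left Nat.card_pos hq1
  obtain ⟨α, hα⟩ := exists_eq_div_of_nsmul_eq_zero hq (t := φ x x)
    (by rw [← map_nsmul, hx, map_zero])
  obtain ⟨β, hβ⟩ := exists_eq_div_of_nsmul_eq_zero hq (t := φ y y)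
    (by rw [← map_nsmul, hy, map_zero])
  by_cases hpα : (p : ℤ) ∣ α
  swap
  · exact split hx hpα hα
  by_cases hpβ : (p : ℤ) ∣ β
  swap
  · exact split hy hpβ hβ
  rcases hp.eq_two_or_odd' with rfl | hodd
  swap
  -- Here `p` divides `α` and `β` but not `2 * u`, so `x + y` has a square with numerator prime to
  -- `p`.
  · refine split (z := x + y) (c := α + u + (u + β)) (by rw [smul_add, hx, hy, add_zero]) ?_ ?_
    · intro h
      have h2 : (p : ℤ) ∣ 2 * u := by
        have := dvd_sub (dvd_sub h hpα) hpβ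
        rwa [show α + u + (u + β) - α - β = 2 * u by ring] at this
      rcases hpz.dvd_or_dvd h2 with h2 | h2
      · have : p ∣ 2 := by exact_mod_cast h2
        rw [(Nat.prime_dvd_prime_iff_eq hp Nat.prime_two).mp this] at hodd
        exact absurd hodd (by decide)
      · exact hu h2
    · simp only [map_add, LinearMap.add_apply, hφ.symm y x, hα, hβ, hxy, coe_div_add]
  -- `x`, `y` span an even block; adding `[u/2^k]` with generator `w` makes `x + w`, `y - w`
  -- orthogonal vectors of odd square
  set q := 2 ^ k
  set φ' := prodPairing φ (cyclicPairing u q) with hφ'_def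
  have hw : ∀ s t : ℤ, cyclicPairing u q (s : ZMod q) (t : ZMod q)
      = (((u * s * t : ℤ) / q : ℚ) : QmodZ) := cyclicPairing_apply' u q
  have hφ' : IsNondegenerate φ' :=
    hφ.prod (isLinkingPairing_cyclicPairing hq (hcop hu)).isNondegenerate
  have hodd {γ : ℤ} (h : ((2 : ℕ) : ℤ) ∣ γ) : ¬ ((2 : ℕ) : ℤ) ∣ γ + u := fun h' =>
    hu ((dvd_add_right h).mp h')
  have hqM : q ∣ M := hdvd.trans hM
  have hz : q • ((x, ((1 : ℤ) : ZMod q)) : G × ZMod q) = 0 := by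
    ext <;> simp [hx]
  have hz' : q • ((y, ((-1 : ℤ) : ZMod q)) : G × ZMod q) = 0 := by
    ext <;> simp [hy]
  have hzz : φ' (x, ((1 : ℤ) : ZMod q)) (x, ((1 : ℤ) : ZMod q))
      = (((α + u : ℤ) / q : ℚ) : QmodZ) := by
    rw [prodPairing_apply, hw, hα, coe_div_add]; congr 3; ring
  have hzz' : φ' (y, ((-1 : ℤ) : ZMod q)) (y, ((-1 : ℤ) : ZMod q))
      = (((β + u : ℤ) / q : ℚ) : QmodZ) := by
    rw [prodPairing_apply, hw, hβ, coe_div_add]; congr 3; ring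
  have horth : φ' (x, ((1 : ℤ) : ZMod q)) (y, ((-1 : ℤ) : ZMod q)) = 0 := by
    rw [prodPairing_apply, hw, hxy, coe_div_add, coe_div_eq_zero_iff hq]
    exact ⟨0, by ring⟩
  refine .of_prod_diagonal (isDiagonal_cyclicPairing hq (hcop hu) hqM)
    (.of_orthogonal hφ' hq hqM hz (hcop (hodd hpα)) hzz ?_)
  have hψ := isNondegenerate_orthogonalPairing hφ' hq hz (hcop (hodd hpα)) hzz
  have hcard := card_eq_mul_card_orthogonal hφ' hq hz (hcop (hodd hpα)) hzz
  generalize hψ_def : orthogonalPairing φ' (x, ((1 : ℤ) : ZMod q)) = ψ at hψ ⊢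
  let z' : LinearMap.ker (φ' (x, ((1 : ℤ) : ZMod q))) := ⟨_, horth⟩
  have hz'' : q • z' = 0 := Subtype.ext hz'
  have hzz'' : ψ z' z' = (((β + u : ℤ) / q : ℚ) : QmodZ) := by rw [← hψ_def]; exact hzz'
  have hcard' := card_eq_mul_card_orthogonal hψ hq hz'' (hcop (hodd hpβ)) hzz''
  -- Adding `ZMod q` multiplies the order by `q`, and the two splittings divide it by `q ^ 2`; the
  -- order left is that of `G` divided by `q`.
  rw [Nat.card_prod, Nat.card_zmod, mul_comm, Nat.mul_right_inj hq.ne', hcard'] at hcard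
  have : NeZero q := ⟨hq.ne'⟩
  refine .of_orthogonal hψ hq hqM hz'' (hcop (hodd hpβ)) hzz'' (ih _ ?_ _ _
      (isNondegenerate_orthogonalPairing hψ hq hz'' (hcop (hodd hpβ)) hzz'') rfl
      ((Dvd.intro_left _ hcard.symm).trans hM))
  rw [← hn, hcard]
  exact lt_mul_of_one_lt_left Nat.card_pos hq1

/-! ### Four squares and quaternion multiplication. -/

section FourSquares

variable {R : Type*} [CommRing R]

/-- Left multiplication by the quaternion `x + y i + z j + w k` with entries in `R`. -/
def quaternionMul (x y z w : R) : R × R × R × R →+ R × R × R × R where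
  toFun v := (x * v.1 - y * v.2.1 - z * v.2.2.1 - w * v.2.2.2,
    x * v.2.1 + y * v.1 + z * v.2.2.2 - w * v.2.2.1,
    x * v.2.2.1 - y * v.2.2.2 + z * v.1 + w * v.2.1,
    x * v.2.2.2 + y * v.2.2.1 - z * v.2.1 + w * v.1)
  map_zero' := by simp
  map_add' u v := by
    ext <;> simp <;> ring

theorem quaternionMul_conj (x y z w : R) (v : R × R × R × R) :
    quaternionMul x y z w (quaternionMul x (-y) (-z) (-w) v)
      = (x ^ 2 + y ^ 2 + z ^ 2 + w ^ 2) • v := by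
  ext <;> simp [quaternionMul] <;> ring

/-- Euler's four-square identity, polarised: left multiplication scales the standard form by the
norm. It is invertible, with inverse `c` times the conjugate. -/
theorem isIsometric_quaternionMul {φ ψ : Pairing R} {l : R → QmodZ}
    (x y z w c : R) (hc : (x ^ 2 + y ^ 2 + z ^ 2 + w ^ 2) * c = 1)
    (hadd : ∀ r s, l (r + s) = l r + l s)
    (hφ : ∀ u v, φ u v = l ((x ^ 2 + y ^ 2 + z ^ 2 + w ^ 2) * (u * v)))
    (hψ : ∀ u v, ψ u v = l (u * v)) :
    IsIsometric (prodPairing φ (prodPairing φ (prodPairing φ φ)))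
      (prodPairing ψ (prodPairing ψ (prodPairing ψ ψ))) := by
  have hbij : Function.Bijective (quaternionMul x y z w) := by
    constructor
    · refine Function.LeftInverse.injective
        (g := fun v => c • quaternionMul x (-y) (-z) (-w) v) fun v => ?_
      have h := quaternionMul_conj x (-y) (-z) (-w) v
      simp only [neg_neg, neg_sq] at h
      simp only [h, smul_smul, mul_comm c, hc, one_smul]
    · intro v
      refine ⟨quaternionMul x (-y) (-z) (-w) (c • v), ?_⟩
      rw [quaternionMul_conj, smul_smul, hc, one_smul]
  refine ⟨AddEquiv.ofBijective _ hbij, fun u v => ?_⟩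
  simp only [AddEquiv.ofBijective_apply, prodPairing_apply, hφ, hψ, ← hadd]
  congr 1
  simp only [quaternionMul, AddMonoidHom.coe_mk, ZeroHom.coe_mk]
  ring

end FourSquares

theorem cyclicPairing_eq_smul (b : ℤ) (a : ℕ) (x y : ZMod a) :
    cyclicPairing b a x y = zmodToQmodZ a (b * (x * y)) := by
  rw [← zsmul_eq_mul, map_zsmul]; rfl

theorem exists_four_squares_zmod {a : ℕ} (ha : 0 < a) (b : ℤ) :
    ∃ x y z w : ZMod a, x ^ 2 + y ^ 2 + z ^ 2 + w ^ 2 = b := by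
  have : NeZero a := ⟨ha.ne'⟩
  obtain ⟨x, y, z, w, h⟩ := Nat.sum_four_squares (b : ZMod a).val
  exact ⟨x, y, z, w, by exact_mod_cast (congrArg (Nat.cast : ℕ → ZMod a) h).trans (by simp)⟩

/-- Working over the product ring `∀ i, ZMod (a i)` treats all summands with a single quaternion, of
norm `b`, a unit there. -/
theorem isIsometric_four_copies {ι : Type*} [Fintype ι] {a : ι → ℕ} {b : ι → ℤ}
    (ha : ∀ i, 0 < a i) (hb : ∀ i, IsCoprime (b i) (a i : ℤ)) {φ ψ : Pairing (∀ i, ZMod (a i))}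
    (hφ : φ = piPairing fun i => cyclicPairing (b i) (a i))
    (hψ : ψ = piPairing fun i => cyclicPairing 1 (a i)) :
    IsIsometric (prodPairing φ (prodPairing φ (prodPairing φ φ)))
      (prodPairing ψ (prodPairing ψ (prodPairing ψ ψ))) := by
  choose x y z w h using fun i => exists_four_squares_zmod (ha i) (b i)
  choose c d hcd using hb
  refine isIsometric_quaternionMul (l := fun r => ∑ i, zmodToQmodZ (a i) (r i))
    x y z w (fun i => (c i : ZMod (a i))) ?_ ?_ ?_ ?_
  · funext i
    simp only [Pi.mul_apply, Pi.add_apply, Pi.pow_apply, h, Pi.one_apply]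
    have := congrArg (Int.cast : ℤ → ZMod (a i)) (hcd i)
    push_cast at this
    simpa [mul_comm] using this
  · intro r s
    simp [Finset.sum_add_distrib]
  · intro u v
    simp [hφ, piPairing_apply, cyclicPairing_eq_smul, h]
  · intro u v
    simp [hψ, piPairing_apply, cyclicPairing_eq_smul]

/-! ### Diagonal matrices and the conclusion. -/

theorem isIsometric_piPairing_iota {ν : ℕ} {a : Fin ν → ℕ} (ha : ∀ i, 0 < a i)
    (hdet : (Matrix.diagonal fun i => (a i : ℤ)).det ≠ 0) :
    IsIsometric (piPairing fun i => cyclicPairing 1 (a i))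
      (iota (Matrix.diagonal fun i => (a i : ℤ)) (Matrix.isSymm_diagonal _) hdet) := by
  let f : (Fin ν → ℤ) →ₗ[ℤ] ∀ i, ZMod (a i) :=
    LinearMap.pi fun i => (Int.castAddHom (ZMod (a i))).toIntLinearMap.comp (LinearMap.proj i)
  have hf (v : Fin ν → ℤ) (i : Fin ν) : f v i = (v i : ZMod (a i)) := rfl
  have hker : LinearMap.range (Matrix.diagonal fun i => (a i : ℤ)).mulVecLin
      = LinearMap.ker f := by
    ext v
    simp only [LinearMap.mem_range, LinearMap.mem_ker, funext_iff, hf, Matrix.mulVecLin_apply,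
      Matrix.mulVec_diagonal, Pi.zero_apply, ZMod.intCast_zmod_eq_zero_iff_dvd]
    constructor
    · rintro ⟨w, hw⟩ i
      exact ⟨w i, (hw i).symm⟩
    · intro h
      choose w hw using h
      exact ⟨w, fun i => (hw i).symm⟩
  have hsurj : Function.Surjective f := fun v => by
    choose w hw using fun i => ZMod.intCast_surjective (v i)
    exact ⟨w, funext hw⟩
  let e := (Submodule.quotEquivOfEq _ _ hker).trans (f.quotKerEquivOfSurjective hsurj)
  have he (v : Fin ν → ℤ) : e.toAddEquiv (Submodule.Quotient.mk v) = f v := rfl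
  refine IsIsometric.symm ⟨e.toAddEquiv, fun x y => ?_⟩
  obtain ⟨x, rfl⟩ := Submodule.Quotient.mk_surjective _ x
  obtain ⟨y, rfl⟩ := Submodule.Quotient.mk_surjective _ y
  have hinv : ((Matrix.diagonal fun i => (a i : ℤ)).map (Int.cast : ℤ → ℚ))⁻¹
      = Matrix.diagonal fun i => (a i : ℚ)⁻¹ := by
    refine Matrix.inv_eq_right_inv ?_
    rw [Matrix.diagonal_map (by simp), Matrix.diagonal_mul_diagonal, ← Matrix.diagonal_one]
    congr 1
    funext i
    have : (a i : ℚ) ≠ 0 := by exact_mod_cast (ha i).ne'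
    simp [this]
  have hsum (g : Fin ν → ℚ) : ((∑ i, g i : ℚ) : QmodZ) = ∑ i, (g i : QmodZ) :=
    map_sum (QuotientAddGroup.mk' (AddSubgroup.zmultiples (1 : ℚ))) _ _
  rw [iota_mk, hinv, he, he, piPairing_apply, dotProduct, hsum]
  refine Finset.sum_congr rfl fun i _ => ?_
  rw [hf, hf, cyclicPairing_apply, Matrix.mulVec_diagonal]
  congr 1
  push_cast
  ring

/-- Any diagonal pairing can be completed by a diagonal one to the pairing of a diagonal matrix. -/
theorem IsDiagonal.exists_isIsometric_iota {M : ℕ} {G : Type*} [AddCommGroup G] {φ : Pairing G}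
    (h : IsDiagonal M φ) :
    ∃ (K : Type) (_ : AddCommGroup K) (ψ : Pairing K), IsDiagonal M ψ ∧
      ∃ (ν : ℕ) (n : Fin ν → ℤ) (hdet : (Matrix.diagonal n).det ≠ 0),
        IsIsometric (prodPairing φ ψ)
          (iota (Matrix.diagonal n) (Matrix.isSymm_diagonal n) hdet) := by
  obtain ⟨N, a, b, hab, e⟩ := h
  have hdiag := IsDiagonal.of_fintype hab
  have e4 := isIsometric_four_copies (fun i => (hab i).1) (fun i => (hab i).2.1) rfl rfl
  let A : Fin N ⊕ (Fin N ⊕ (Fin N ⊕ Fin N)) → ℕ :=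
    Sum.elim a (Sum.elim a (Sum.elim a a))
  have hA : ∀ i, 0 < A i := by
    rintro (i | i | i | i) <;> exact (hab i).1
  have eA : IsIsometric
      (prodPairing (piPairing fun i => cyclicPairing 1 (a i))
        (prodPairing (piPairing fun i => cyclicPairing 1 (a i))
          (prodPairing (piPairing fun i => cyclicPairing 1 (a i))
            (piPairing fun i => cyclicPairing 1 (a i)))))
      (piPairing fun i => cyclicPairing 1 (A i)) := by
    refine IsIsometric.symm ((isIsometric_piPairing_sum _).trans ((IsIsometric.refl _).prod ?_))
    refine (isIsometric_piPairing_sum _).trans ((IsIsometric.refl _).prod ?_)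
    exact isIsometric_piPairing_sum _
  let σ := (Fintype.equivFin (Fin N ⊕ (Fin N ⊕ (Fin N ⊕ Fin N)))).symm
  have hdet : (Matrix.diagonal fun i => (A (σ i) : ℤ)).det ≠ 0 := by
    rw [Matrix.det_diagonal]
    exact Finset.prod_ne_zero_iff.mpr fun i _ => by exact_mod_cast (hA (σ i)).ne'
  -- The complement is three further copies of the diagonal form of `φ`.
  exact ⟨_, _, _, hdiag.prod (hdiag.prod hdiag), _, _, hdet,
    (((e.prod (.refl _)).trans e4).trans eA).trans
      ((isIsometric_piPairing_reindex σ _).trans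
        (isIsometric_piPairing_iota (fun i => hA (σ i)) hdet))⟩

end Ohtsuki

theorem lemmaA1 {G : Type*} [AddCommGroup G] [Finite G] (φ : Ohtsuki.Pairing G)
    (hφ : Ohtsuki.IsLinkingPairing φ) :
    ∃ (N : ℕ) (a : Fin N → ℕ) (b : Fin N → ℤ) (ν : ℕ) (n : Fin ν → ℤ)
      (hdet : (Matrix.diagonal n).det ≠ 0),
      (∀ i, 0 < a i) ∧
      (∀ i, Ohtsuki.IsLinkingPairing (Ohtsuki.cyclicPairing (b i) (a i))) ∧
      (∀ i, a i ∣ Nat.card G) ∧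
      Ohtsuki.IsIsometric
        (Ohtsuki.prodPairing φ
          (Ohtsuki.piPairing fun i => Ohtsuki.cyclicPairing (b i) (a i)))
        (Ohtsuki.iota (Matrix.diagonal n) (Matrix.isSymm_diagonal n) hdet) := by
  obtain ⟨K, _, ψ, hψ, hφψ⟩ :=
    Ohtsuki.isStablyDiagonal_of_isNondegenerate (Nat.card G) _ G φ hφ.isNondegenerate rfl dvd_rfl
  obtain ⟨L, _, χ, hχ, ν, n, hdet, e⟩ := hφψ.exists_isIsometric_iota
  -- `ψ` makes `φ` diagonal and `χ` then reaches `ι`; together they supply the pairings `[b i / a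
  -- i]`.
  obtain ⟨N, a, b, hab, f⟩ := hψ.prod hχ
  exact ⟨N, a, b, ν, n, hdet, fun i => (hab i).1,
    fun i => Ohtsuki.isLinkingPairing_cyclicPairing (hab i).1 (hab i).2.1, fun i => (hab i).2.2,
    ((Ohtsuki.IsIsometric.refl φ).prod f.symm).trans
      ((Ohtsuki.isIsometric_prod_assoc φ ψ χ).symm.trans e)⟩
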